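/- Let $n\ge 1$. A cube is a closed axis-parallel cube $Q\subset\mathbb{R}^n$ of positive side length, and $|\cdot|$ is Lebesgue measure. For a (Lebesgue) measurable $f\colon\mathbb{R}^n\to\mathbb{R}$, a number $\alpha\in\mathbb{R}$ is a median of $f$ on $Q$ if $$|Q\cap\{f<\alpha\}|\le |Q|/2\quad\text{and}\quad |Q\cap\{f>\alpha\}|\le |Q|/2 .$$ The medians of $f$ on $Q$ form a non-empty compact interval; let $m_f(Q)$ be a median with the largest absolute value. The median maximal operator is $$\mathcal{M}f(x)=\sup_{Q\ni x}|m_f(Q)|\in[0,\infty],\qquad x\in\mathbb{R}^n,$$ the supremum being over all cubes $Q$ containing $x$. A weight is a measurable function $w\colon\mathbb{R}^n\to[0,\infty)$; write $w(Q)=\int_Q w$. Put $$[w]_{A_1}=\sup_Q \frac{w(Q)}{|Q|}\,\|w^{-1}\|_{L^\infty(Q)},\qquad [w]_{A_q}=\sup_Q \frac{w(Q)}{|Q|}\Big(\frac{1}{|Q|}\int_Q w^{-1/(q-1)}\Big)^{q-1}\quad(1<q<\infty),$$ where the suprema are over all cubes, $0$ raised to a negative power is $\infty$, and $0\cdot\infty=0$.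 Let $A_q$ be the class of weights with $[w]_{A_q}<\infty$, and $A_\infty=\bigcup_{1\le q<\infty}A_q$. Theorem. Let $w$ be a weight on $\mathbb{R}^n$ and let $p\in(0,\infty)$. Then $\mathcal{M}$ is bounded on $L^p(w)$ if and only if $w\in A_\infty$. Here $\mathcal{M}$ is bounded on $L^p(w)$ if there is a constant $C<\infty$ such that for every measurable $f\colon\mathbb{R}^n\to\mathbb{R}$ with $\int_{\mathbb{R}^n}|f|^p\,w\,dx<\infty$, the function $\mathcal{M}f$ is measurable and $$\Big(\int_{\mathbb{R}^n}(\mathcal{M}f)^p\,w\,dx\Big)^{1/p}\le C\Big(\int_{\mathbb{R}^n}|f|^p\,w\,dx\Big)^{1/p}.$$ -/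

import Mathlib

open MeasureTheory Set
open scoped ENNReal NNReal

namespace MedianMaximal

variable {n : ℕ}

/-- `Q` is a (closed, non-degenerate, axis-parallel) cube in `ℝⁿ`: the cube with centre `c` and
side length `2 * r`, for some `c` and some `r > 0`. -/
def IsCube (Q : Set (Fin n → ℝ)) : Prop :=
  ∃ (c : Fin n → ℝ) (r : ℝ), 0 < r ∧ Q = Icc (fun i => c i - r) (fun i => c i + r)

/-- `α` is a median of `f` on `Q`. -/
def IsMedian (f : (Fin n → ℝ) → ℝ) (Q : Set (Fin n → ℝ)) (α : ℝ) : Prop :=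
  volume (Q ∩ {x | f x < α}) ≤ volume Q / 2 ∧ volume (Q ∩ {x | α < f x}) ≤ volume Q / 2

/-- `α` is a median of `f` on `Q` with the largest absolute value. -/
def IsLargestMedian (f : (Fin n → ℝ) → ℝ) (Q : Set (Fin n → ℝ)) (α : ℝ) : Prop :=
  IsMedian f Q α ∧ ∀ β, IsMedian f Q β → |β| ≤ |α|

open Classical in
/-- The median `m_f(Q)` of `f` on `Q` with the largest absolute value. For a cube `Q` and a
measurable `f` it exists, see `isLargestMedian_largestMedian`. Its absolute value is unique
(and only the absolute value is used). -/
noncomputable def largestMedian (f : (Fin n → ℝ) → ℝ) (Q : Set (Fin n → ℝ)) : ℝ :=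
  if h : ∃ α, IsLargestMedian f Q α then h.choose else 0

/-- The median maximal function `𝓜 f (x) = sup_{Q ∋ x} |m_f(Q)|`, with values in `[0, ∞]`. -/
noncomputable def medianMaximal (f : (Fin n → ℝ) → ℝ) (x : Fin n → ℝ) : ℝ≥0∞ :=
  ⨆ (Q : Set (Fin n → ℝ)) (_ : IsCube Q) (_ : x ∈ Q), ENNReal.ofReal |largestMedian f Q|

/-- The measure `w dx` associated with a weight `w`. -/
noncomputable def weightMeasure (w : (Fin n → ℝ) → ℝ≥0) : Measure (Fin n → ℝ) :=
  volume.withDensity (fun x => (w x : ℝ≥0∞))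

/-- `T`, acting on real Lebesgue measurable functions, is bounded on `L^p(w)`, `0 < p < ∞`: there
is a finite constant `C` such that, for all `f ∈ L^p(w)`, the function `T f` is Lebesgue measurable
and `‖T f‖_{L^p(w)} ≤ C ‖f‖_{L^p(w)}`. -/
def IsBoundedOnLp (T : ((Fin n → ℝ) → ℝ) → (Fin n → ℝ) → ℝ≥0∞) (p : ℝ)
    (w : (Fin n → ℝ) → ℝ≥0) : Prop :=
  ∃ C : ℝ≥0, ∀ f : (Fin n → ℝ) → ℝ, AEMeasurable f volume →
    eLpNorm f (ENNReal.ofReal p) (weightMeasure w) < ∞ →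
      AEMeasurable (T f) volume ∧
        eLpNorm (T f) (ENNReal.ofReal p) (weightMeasure w) ≤
          C * eLpNorm f (ENNReal.ofReal p) (weightMeasure w)

/-- The constant `[w]_{A_1} = sup_Q (w(Q) / |Q|) ‖w⁻¹‖_{L^∞(Q)}` (in `[0, ∞]`, with `0⁻¹ = ∞` and
`0 * ∞ = 0`). -/
noncomputable def a1Const (w : (Fin n → ℝ) → ℝ≥0) : ℝ≥0∞ :=
  ⨆ (Q : Set (Fin n → ℝ)) (_ : IsCube Q),
    (∫⁻ x in Q, (w x : ℝ≥0∞)) / volume Q *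
      essSup (fun x => (w x : ℝ≥0∞)⁻¹) (volume.restrict Q)

/-- The constant `[w]_{A_p} = sup_Q (w(Q) / |Q|) (σ(Q) / |Q|)^(p-1)` with `σ = w^(-1/(p-1))`, for
`1 < p < ∞` (in `[0, ∞]`, with `0^(-1/(p-1)) = ∞` and `0 * ∞ = 0`). -/
noncomputable def apConst (p : ℝ) (w : (Fin n → ℝ) → ℝ≥0) : ℝ≥0∞ :=
  ⨆ (Q : Set (Fin n → ℝ)) (_ : IsCube Q),
    (∫⁻ x in Q, (w x : ℝ≥0∞)) / volume Q *
      ((∫⁻ x in Q, (w x : ℝ≥0∞) ^ (-1 / (p - 1))) / volume Q) ^ (p - 1)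

/-- The class `A_∞`, the union of the Muckenhoupt classes `A_p`, `1 ≤ p < ∞`. -/
def IsAInfty (w : (Fin n → ℝ) → ℝ≥0) : Prop :=
  a1Const w < ∞ ∨ ∃ p : ℝ, 1 < p ∧ apConst p w < ∞

theorem IsCube.volume_ne_zero {Q : Set (Fin n → ℝ)} (hQ : IsCube Q) : volume Q ≠ 0 := by
  obtain ⟨c, r, hr, rfl⟩ := hQ
  rw [Real.volume_Icc_pi, Finset.prod_ne_zero_iff]
  intro i _
  rw [ne_eq, ENNReal.ofReal_eq_zero, not_le]
  linarith

theorem IsCube.volume_ne_top {Q : Set (Fin n → ℝ)} (hQ : IsCube Q) : volume Q ≠ ∞ := by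
  obtain ⟨c, r, hr, rfl⟩ := hQ
  exact isCompact_Icc.measure_ne_top

theorem IsCube.measurableSet {Q : Set (Fin n → ℝ)} (hQ : IsCube Q) : MeasurableSet Q := by
  obtain ⟨c, r, hr, rfl⟩ := hQ
  exact measurableSet_Icc

/-- A bound for all superlevel sets above `α` passes to `α`. -/
theorem measure_lt_le_of_forall {μ : Measure (Fin n → ℝ)} {g : (Fin n → ℝ) → ℝ} {α : ℝ} {b : ℝ≥0∞}
    (h : ∀ t, α < t → μ {x | t < g x} ≤ b) : μ {x | α < g x} ≤ b := by
  have hU : {x | α < g x} = ⋃ k : ℕ, {x | α + 1 / ((k : ℝ) + 1) < g x} := by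
    ext x
    simp only [mem_ofPred_eq, mem_iUnion]
    constructor
    · intro hx
      obtain ⟨k, hk⟩ := exists_nat_one_div_lt (sub_pos.2 hx)
      exact ⟨k, by linarith⟩
    · rintro ⟨k, hk⟩
      have : (0 : ℝ) < 1 / ((k : ℝ) + 1) := by positivity
      linarith
  have hm : Monotone fun k : ℕ => {x | α + 1 / ((k : ℝ) + 1) < g x} := by
    intro k l hkl x hx
    have : 1 / ((l : ℝ) + 1) ≤ 1 / ((k : ℝ) + 1) := by gcongr
    simp only [mem_ofPred_eq] at hx ⊢
    linarith
  rw [hU, hm.measure_iUnion]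
  refine iSup_le fun k => h _ ?_
  have : (0 : ℝ) < 1 / ((k : ℝ) + 1) := by positivity
  linarith

/-- Superlevel sets at high levels have small measure. -/
theorem exists_measure_lt_lt {μ : Measure (Fin n → ℝ)} [IsFiniteMeasure μ] {g : (Fin n → ℝ) → ℝ}
    (hg : AEMeasurable g μ) {b : ℝ≥0∞} (hb : 0 < b) : ∃ t : ℝ, μ {x | t < g x} < b := by
  have hI : (⋂ k : ℕ, {x | (k : ℝ) < g x}) = ∅ := by
    refine eq_empty_of_forall_notMem fun x hx => ?_
    obtain ⟨k, hk⟩ := exists_nat_ge (g x)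
    exact absurd (mem_iInter.1 hx k) (not_lt.2 hk)
  have hT := tendsto_measure_iInter_atTop (μ := μ) (s := fun k : ℕ => {x | (k : ℝ) < g x})
    (fun k => nullMeasurableSet_lt aemeasurable_const hg)
    (fun k l hkl x (hx : (l : ℝ) < g x) => show (k : ℝ) < g x from
      lt_of_le_of_lt (Nat.cast_le.2 hkl) hx) ⟨0, measure_ne_top _ _⟩
  rw [hI, measure_empty] at hT
  obtain ⟨k, hk⟩ := (hT.eventually (gt_mem_nhds hb)).exists
  exact ⟨k, hk⟩

/-- A measurable function has a median with the largest absolute value on every cube. -/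
theorem exists_isLargestMedian {f : (Fin n → ℝ) → ℝ} (hf : AEMeasurable f volume)
    {Q : Set (Fin n → ℝ)} (hQ : IsCube Q) : ∃ α, IsLargestMedian f Q α := by
  set μ : Measure (Fin n → ℝ) := volume.restrict Q with hμ
  have : IsFiniteMeasure μ := ⟨by simpa [hμ] using hQ.volume_ne_top.lt_top⟩
  have hfμ : AEMeasurable f μ := hf.restrict
  set b : ℝ≥0∞ := volume Q / 2 with hb
  have hb0 : 0 < b := ENNReal.half_pos hQ.volume_ne_zero
  have hU : μ univ = b + b := by simp [hμ, hb, ENNReal.add_halves]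
  have hiff : ∀ α, IsMedian f Q α ↔ μ {x | f x < α} ≤ b ∧ μ {x | α < f x} ≤ b := by
    intro α
    simp only [IsMedian, hμ, Measure.restrict_apply' hQ.measurableSet, inter_comm Q, hb]
  have hlt : ∀ α, (∀ t, t < α → μ {x | f x < t} ≤ b) → μ {x | f x < α} ≤ b := by
    intro α h
    have := measure_lt_le_of_forall (μ := μ) (g := fun x => -f x) (α := -α) (b := b)
      (fun t ht => by simpa [lt_neg] using h (-t) (by linarith))
    simpa using this
  have hsplit : ∀ t, μ {x | f x ≤ t} + μ {x | t < f x} = b + b := by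
    intro t
    rw [← hU, ← measure_add_measure_compl₀ (nullMeasurableSet_le hfμ aemeasurable_const :
      NullMeasurableSet {x | f x ≤ t} μ)]
    congr 2
    ext x
    simp
  obtain ⟨t₁, ht₁⟩ := exists_measure_lt_lt hfμ hb0
  obtain ⟨t₂', ht₂'⟩ := exists_measure_lt_lt hfμ.neg hb0
  obtain ⟨t₂, rfl⟩ : ∃ t₂, t₂' = -t₂ := ⟨-t₂', by simp⟩
  have ht₂ : μ {x | f x < t₂} < b := by simpa using ht₂'
  have hlow : ∀ t, t < t₂ → b < μ {x | t < f x} := by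
    intro t ht
    by_contra! h
    have h1 : μ {x | f x ≤ t} < b :=
      (measure_mono fun x (hx : f x ≤ t) => lt_of_le_of_lt hx ht).trans_lt ht₂
    exact (ENNReal.add_lt_add_of_lt_of_le (measure_ne_top _ _) h1 h).ne (hsplit t)
  have hup : ∀ t, t₁ < t → b < μ {x | f x < t} := by
    intro t ht
    by_contra! h
    have h1 : μ {x | f x ≤ t₁} ≤ b :=
      (measure_mono fun x (hx : f x ≤ t₁) => lt_of_le_of_lt hx ht).trans h
    refine (ENNReal.add_lt_add_of_le_of_lt (measure_ne_top _ _) h1 ht₁).ne (hsplit t₁)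
  set S : Set ℝ := {α | IsMedian f Q α} with hS
  have hsub : S ⊆ Icc t₂ t₁ := by
    intro α hα
    obtain ⟨h1, h2⟩ := (hiff α).1 hα
    exact ⟨not_lt.1 fun h => absurd h2 (not_le.2 (hlow α h)),
      not_lt.1 fun h => absurd h1 (not_le.2 (hup α h))⟩
  have hcl : IsClosed S := by
    refine isClosed_of_closure_subset fun α hα => (hiff α).2 ⟨hlt α fun t ht => ?_,
      measure_lt_le_of_forall fun t ht => ?_⟩
    · obtain ⟨s, hs, hsS⟩ := mem_closure_iff.1 hα (Ioi t) isOpen_Ioi ht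
      exact (measure_mono fun x (hx : f x < t) => hx.trans hs).trans ((hiff s).1 hsS).1
    · obtain ⟨s, hs, hsS⟩ := mem_closure_iff.1 hα (Iio t) isOpen_Iio ht
      exact (measure_mono fun x (hx : t < f x) => lt_trans hs hx).trans ((hiff s).1 hsS).2
  have hne : S.Nonempty := by
    set T : Set ℝ := {t | μ {x | t < f x} ≤ b} with hT
    have hTb : BddBelow T := ⟨t₂, fun t ht => not_lt.1 fun h => absurd ht (not_le.2 (hlow t h))⟩
    have hTn : T.Nonempty := ⟨t₁, ht₁.le⟩
    refine ⟨sInf T, (hiff _).2 ⟨hlt _ fun t ht => ?_, measure_lt_le_of_forall fun t ht => ?_⟩⟩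
    · have h1 : b < μ {x | t < f x} := not_le.1 fun h => absurd (csInf_le hTb h) (not_le.2 ht)
      have h2 : μ {x | f x ≤ t} ≤ b := by
        by_contra! h
        exact (ENNReal.add_lt_add h h1).ne' (hsplit t)
      exact (measure_mono fun x (hx : f x < t) => hx.le).trans h2
    · obtain ⟨s, hs, hst⟩ := exists_lt_of_csInf_lt hTn ht
      exact (measure_mono fun x (hx : t < f x) => hst.trans hx).trans hs
  obtain ⟨α, hα, hmax⟩ := (isCompact_Icc.of_isClosed_subset hcl hsub).exists_isMaxOn hne
    continuous_abs.continuousOn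
  exact ⟨α, hα, fun β hβ => hmax hβ⟩

theorem isLargestMedian_largestMedian {f : (Fin n → ℝ) → ℝ} (hf : AEMeasurable f volume)
    {Q : Set (Fin n → ℝ)} (hQ : IsCube Q) : IsLargestMedian f Q (largestMedian f Q) := by
  have h := exists_isLargestMedian hf hQ
  rw [largestMedian, dif_pos h]
  exact h.choose_spec

end MedianMaximal

/-!
If a median of `f` on a cube exceeds `t` in absolute value, then `{|f| > t}` fills at least half of
the cube. Hence `{𝓜 f > t}` lies in the half-density hull of `{|f| > t}`, and the boundedness of `𝓜`
on `L^p(w)`, for whichever `p`, amounts to `w(hull S) ≤ K w(S)` for all measurable `S`.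

An `A_q` weight satisfies `w(Q) ≤ C w(F)` whenever `F ⊆ Q` has volume comparable to that of `Q`, by
Hölder's inequality; a Vitali covering turns this into the hull inequality. Conversely, as long as
`S` fills at most half of a cube `Q`, adding to `S` the subcubes that it fills exactly by half
multiplies `|S|` by a factor `λ > 1` and `w(S)` by at most `K + 1`. Starting from
`S = {x ∈ Q | Lᴺ w x < w(Q) / |Q|}` with `L` larger than a power of `K + 1`, `N` such steps cannot
reach half of `Q`, so that `|S| ≤ λ⁻ᴺ |Q|`. This geometric decay makes a small negative power of `w`
integrable on cubes with the right constant, which is the `A_q` condition.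
-/

open Filter Metric Module Topology

namespace MedianMaximal

section MeasureSpace

variable {α : Type*} [MeasurableSpace α] {μ : Measure α}

theorem measure_le_two_mul_of_subset_union {Q S T : Set α} (hQ : μ Q ≠ ∞) (hS : μ S ≤ μ Q / 2)
    (h : Q ⊆ S ∪ T) : μ Q ≤ 2 * μ T := by
  have hadd : μ Q / 2 + μ Q / 2 ≤ μ Q / 2 + μ T :=
    calc μ Q / 2 + μ Q / 2 = μ Q := ENNReal.add_halves _
      _ ≤ μ S + μ T := (measure_mono h).trans (measure_union_le _ _)
      _ ≤ μ Q / 2 + μ T := by gcongr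
  rwa [ENNReal.add_le_add_iff_left (ENNReal.div_ne_top hQ (by simp)),
    ENNReal.div_le_iff' (by simp) (by simp)] at hadd

theorem measure_sdiff_le_half {E Q : Set α} (hE : NullMeasurableSet E μ) (hQ : μ Q ≠ ∞)
    (h : μ Q ≤ 2 * μ (E ∩ Q)) : μ (Q \ E) ≤ μ Q / 2 := by
  have hsplit : μ Q / 2 + μ (Q \ E) ≤ μ Q / 2 + μ Q / 2 :=
    calc μ Q / 2 + μ (Q \ E) ≤ μ (Q ∩ E) + μ (Q \ E) := by
          gcongr
          rwa [inter_comm, ENNReal.div_le_iff' (by simp) (by simp)]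
      _ = μ Q := measure_inter_add_sdiff₀ Q hE
      _ = μ Q / 2 + μ Q / 2 := (ENNReal.add_halves _).symm
  rwa [ENNReal.add_le_add_iff_left (ENNReal.div_ne_top hQ (by simp))] at hsplit

theorem lintegral_rpow_eq_lintegral_meas_lt_of_ne_top {f : α → ℝ≥0∞} (hf : AEMeasurable f μ)
    (hf_top : ∀ x, f x ≠ ∞) {p : ℝ} (hp : 0 < p) :
    ∫⁻ x, f x ^ p ∂μ = ENNReal.ofReal p *
      ∫⁻ t in Ioi (0 : ℝ), μ {x | ENNReal.ofReal t < f x} * ENNReal.ofReal (t ^ (p - 1)) := by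
  have hpow (x : α) : f x ^ p = ENNReal.ofReal ((f x).toReal ^ p) := by
    rw [← ENNReal.ofReal_rpow_of_nonneg ENNReal.toReal_nonneg hp.le,
      ENNReal.ofReal_toReal (hf_top x)]
  simp_rw [hpow]
  rw [lintegral_rpow_eq_lintegral_meas_lt_mul μ (.of_forall fun x => ENNReal.toReal_nonneg)
    hf.ennreal_toReal hp]
  congr 1
  refine setLIntegral_congr_fun measurableSet_Ioi fun t ht => ?_
  simp only [ENNReal.ofReal_lt_iff_lt_toReal (mem_Ioi.1 ht).le (hf_top _)]

theorem lintegral_rpow_le_mul_of_measure_lt_le {f g : α → ℝ≥0∞} (hf : AEMeasurable f μ)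
    (hg : AEMeasurable g μ) {K : ℝ≥0∞} {p : ℝ} (hp : 0 < p) (hK : K ≠ ∞)
    (h : ∀ t : ℝ≥0, μ {x | t < g x} ≤ K * μ {x | t < f x}) :
    ∫⁻ x, g x ^ p ∂μ ≤ K * ∫⁻ x, f x ^ p ∂μ := by
  have htrunc (N : ℕ) : ∫⁻ x, min (g x) N ^ p ∂μ ≤ K * ∫⁻ x, min (f x) N ^ p ∂μ := by
    have hne (a : ℝ≥0∞) : min a N ≠ ∞ := ne_top_of_le_ne_top (by simp) (min_le_right a N)
    rw [lintegral_rpow_eq_lintegral_meas_lt_of_ne_top (hg.min aemeasurable_const)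
        (fun x => hne (g x)) hp,
      lintegral_rpow_eq_lintegral_meas_lt_of_ne_top (hf.min aemeasurable_const)
        (fun x => hne (f x)) hp, mul_left_comm, ← lintegral_const_mul' _ _ hK]
    simp_rw [← mul_assoc]
    gcongr with t
    by_cases htN : ENNReal.ofReal t < N
    · simp only [lt_min_iff, htN, and_true]
      exact h t.toNNReal
    · simp [htN]
  have hmono : ∀ᵐ x ∂μ, Monotone fun N : ℕ => min (g x) N ^ p :=
    .of_forall fun x M N hMN => by
      dsimp only
      gcongr
  have hlim : ∀ᵐ x ∂μ, Tendsto (fun N : ℕ => min (g x) N ^ p) atTop (𝓝 (g x ^ p)) :=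
    .of_forall fun x => by
      have hmin := (tendsto_const_nhds (x := g x)).min ENNReal.tendsto_nat_nhds_top
      rw [min_top_right] at hmin
      exact (ENNReal.continuous_rpow_const.tendsto _).comp hmin
  refine le_of_tendsto' (lintegral_tendsto_of_tendsto_of_monotone
    (fun N => (hg.min aemeasurable_const).pow_const p) hmono hlim) fun N => (htrunc N).trans ?_
  gcongr
  exact min_le_left _ _

theorem measure_univ_rpow_le_lintegral_mul_lintegral_dual {w : α → ℝ≥0∞}
    (hw : AEMeasurable w μ) (hw0 : ∀ᵐ x ∂μ, w x ≠ 0) (hw_top : ∀ᵐ x ∂μ, w x ≠ ∞) {q : ℝ}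
    (hq : 1 < q) :
    μ univ ^ q ≤ (∫⁻ x, w x ∂μ) * (∫⁻ x, w x ^ (-1 / (q - 1)) ∂μ) ^ (q - 1) := by
  have hq0 : 0 < q := one_pos.trans hq
  have hq1 : 0 < q - 1 := sub_pos.2 hq
  have hone : ∀ᵐ x ∂μ, w x ^ (1 / q) * w x ^ (-(1 / q)) = 1 := by
    filter_upwards [hw0, hw_top] with x h0 htop
    rw [← ENNReal.rpow_add _ _ h0 htop, add_neg_cancel, ENNReal.rpow_zero]
  have hconj : q.HolderConjugate (q / (q - 1)) := Real.HolderConjugate.conjExponent hq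
  have hholder : μ univ ≤
      (∫⁻ x, w x ∂μ) ^ (1 / q) * (∫⁻ x, w x ^ (-1 / (q - 1)) ∂μ) ^ ((q - 1) / q) :=
    calc μ univ = ∫⁻ x, w x ^ (1 / q) * w x ^ (-(1 / q)) ∂μ := by
          rw [lintegral_congr_ae hone, lintegral_one]
      _ ≤ (∫⁻ x, (w x ^ (1 / q)) ^ q ∂μ) ^ (1 / q) *
          (∫⁻ x, (w x ^ (-(1 / q))) ^ (q / (q - 1)) ∂μ) ^ (1 / (q / (q - 1))) :=
        ENNReal.lintegral_mul_le_Lp_mul_Lq μ hconj (hw.pow_const _) (hw.pow_const _)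
      _ = _ := by
        simp_rw [← ENNReal.rpow_mul, one_div_mul_cancel hq0.ne', ENNReal.rpow_one, one_div_div,
          show -(1 / q) * (q / (q - 1)) = -1 / (q - 1) by field_simp]
  calc μ univ ^ q ≤ _ := ENNReal.rpow_le_rpow hholder hq0.le
    _ = _ := by
      rw [ENNReal.mul_rpow_of_nonneg _ _ hq0.le, ← ENNReal.rpow_mul, ← ENNReal.rpow_mul,
        one_div_mul_cancel hq0.ne', div_mul_cancel₀ _ hq0.ne', ENNReal.rpow_one]

theorem setLIntegral_le_of_measure_le_mul {w : α → ℝ≥0∞} (hw : AEMeasurable w μ)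
    (hw_top : ∀ᵐ x ∂μ, w x ≠ ∞) {q : ℝ} (hq : 1 < q) {F Q : Set α} (hFQ : F ⊆ Q)
    (hQ0 : μ Q ≠ 0) (hQ_top : μ Q ≠ ∞) {A D : ℝ≥0∞} (hA : A ≠ ∞)
    (hAq : (∫⁻ x in Q, w x ∂μ) * (∫⁻ x in Q, w x ^ (-1 / (q - 1)) ∂μ) ^ (q - 1) ≤ A * μ Q ^ q)
    (hD : μ Q ≤ D * μ F) :
    ∫⁻ x in Q, w x ∂μ ≤ D ^ q * A * ∫⁻ x in F, w x ∂μ := by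
  have hq0 : 0 < q := one_pos.trans hq
  have hq1 : 0 < q - 1 := sub_pos.2 hq
  have hQq_top : μ Q ^ q ≠ ∞ := ENNReal.rpow_ne_top_of_nonneg hq0.le hQ_top
  have hQq0 : μ Q ^ q ≠ 0 := by simp [hQ0, hQ_top]
  rcases eq_or_ne (∫⁻ x in Q, w x ∂μ) 0 with hint | hint
  · simp [hint]
  have hdual : ∫⁻ x in Q, w x ^ (-1 / (q - 1)) ∂μ ≠ ∞ := fun hdual => by
    rw [hdual, ENNReal.top_rpow_of_pos hq1, ENNReal.mul_top hint, top_le_iff] at hAq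
    exact ENNReal.mul_ne_top hA hQq_top hAq
  have hw0 : ∀ᵐ x ∂μ.restrict Q, w x ≠ 0 := by
    filter_upwards [ae_lt_top' (hw.restrict.pow_const _) hdual] with x hx h0
    rw [h0, ENNReal.zero_rpow_of_neg (div_neg_of_neg_of_pos (by norm_num) hq1)] at hx
    exact hx.ne rfl
  have hholder := measure_univ_rpow_le_lintegral_mul_lintegral_dual (μ := μ.restrict F)
    hw.restrict (ae_restrict_of_ae_restrict_of_subset hFQ hw0) (ae_restrict_of_ae hw_top) hq
  rw [Measure.restrict_apply_univ] at hholder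
  refine (ENNReal.mul_le_mul_iff_left hQq0 hQq_top).1 ?_
  calc (∫⁻ x in Q, w x ∂μ) * μ Q ^ q ≤ (∫⁻ x in Q, w x ∂μ) * (D * μ F) ^ q := by gcongr
    _ = D ^ q * (∫⁻ x in Q, w x ∂μ) * μ F ^ q := by
      rw [ENNReal.mul_rpow_of_nonneg _ _ hq0.le]
      ring
    _ ≤ D ^ q * (∫⁻ x in Q, w x ∂μ) *
        ((∫⁻ x in F, w x ∂μ) * (∫⁻ x in Q, w x ^ (-1 / (q - 1)) ∂μ) ^ (q - 1)) := by
      gcongr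
      exact hholder.trans (by gcongr)
    _ = D ^ q * (∫⁻ x in F, w x ∂μ) *
        ((∫⁻ x in Q, w x ∂μ) * (∫⁻ x in Q, w x ^ (-1 / (q - 1)) ∂μ) ^ (q - 1)) := by ring
    _ ≤ D ^ q * (∫⁻ x in F, w x ∂μ) * (A * μ Q ^ q) := by gcongr
    _ = D ^ q * A * (∫⁻ x in F, w x ∂μ) * μ Q ^ q := by ring

theorem rpow_le_one_add_tsum_indicator {L : ℝ≥0∞} (hL : 1 < L) (hL_top : L ≠ ∞) {δ : ℝ}
    (hδ : 0 < δ) (y : ℝ≥0∞) :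
    y ^ δ ≤ 1 + ∑' N : ℕ, (L ^ δ) ^ (N + 1) * (Ioi (L ^ N)).indicator 1 y := by
  have hLδ : 1 ≤ L ^ δ := ENNReal.one_le_rpow hL.le hδ
  rcases eq_or_ne y ∞ with rfl | hy
  · have hterm (N : ℕ) : 1 ≤ (L ^ δ) ^ (N + 1) * (Ioi (L ^ N)).indicator 1 ∞ := by
      rw [indicator_of_mem (mem_Ioi.2 (ENNReal.pow_lt_top hL_top.lt_top)), Pi.one_apply, mul_one]
      exact one_le_pow₀ hLδ
    have htop := ENNReal.tsum_le_tsum hterm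
    rw [ENNReal.tsum_const_eq_top_of_ne_zero one_ne_zero, top_le_iff] at htop
    simp [htop]
  · have hfin (N : ℕ) (hN : y ≤ L ^ N) :
        y ^ δ ≤ 1 + ∑' N : ℕ, (L ^ δ) ^ (N + 1) * (Ioi (L ^ N)).indicator 1 y := by
      induction N with
      | zero => exact (ENNReal.rpow_le_one (by simpa using hN) hδ.le).trans le_self_add
      | succ N ih =>
        rcases le_or_gt y (L ^ N) with hyN | hyN
        · exact ih hyN
        calc y ^ δ ≤ (L ^ δ) ^ (N + 1) := by
              rw [← ENNReal.rpow_mul_natCast, mul_comm, ENNReal.rpow_natCast_mul]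
              gcongr
          _ = (L ^ δ) ^ (N + 1) * (Ioi (L ^ N)).indicator 1 y := by simp [hyN]
          _ ≤ ∑' N : ℕ, (L ^ δ) ^ (N + 1) * (Ioi (L ^ N)).indicator 1 y := ENNReal.le_tsum N
          _ ≤ _ := le_add_self
    obtain ⟨N, hN⟩ := ((ENNReal.tendsto_pow_atTop_nhds_top_iff.2 hL).eventually_const_lt
      hy.lt_top).exists
    exact hfin N hN.le

theorem lintegral_rpow_le_of_geometric_decay {f : α → ℝ≥0∞} (hf : AEMeasurable f μ)
    {L θ : ℝ≥0∞} (hL : 1 < L) (hL_top : L ≠ ∞) {δ : ℝ} (hδ : 0 < δ)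
    (h : ∀ N : ℕ, μ {x | L ^ N < f x} ≤ θ ^ N * μ univ) :
    ∫⁻ x, f x ^ δ ∂μ ≤ (1 + L ^ δ * (1 - L ^ δ * θ)⁻¹) * μ univ := by
  have hlevel (N : ℕ) : NullMeasurableSet {x | L ^ N < f x} μ :=
    nullMeasurableSet_lt aemeasurable_const hf
  have hind (N : ℕ) : AEMeasurable (fun x => (Ioi (L ^ N)).indicator (1 : ℝ≥0∞ → ℝ≥0∞) (f x)) μ :=
    (measurable_one.indicator measurableSet_Ioi).comp_aemeasurable hf
  calc ∫⁻ x, f x ^ δ ∂μ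
      ≤ ∫⁻ x, (1 + ∑' N : ℕ, (L ^ δ) ^ (N + 1) * (Ioi (L ^ N)).indicator 1 (f x)) ∂μ :=
        lintegral_mono fun x => rpow_le_one_add_tsum_indicator hL hL_top hδ (f x)
    _ = μ univ + ∑' N : ℕ, (L ^ δ) ^ (N + 1) * μ {x | L ^ N < f x} := by
        rw [lintegral_add_left measurable_const, lintegral_one,
          lintegral_tsum fun N => (hind N).const_mul _]
        congr! 3 with N
        rw [lintegral_const_mul'' _ (hind N)]
        congr 1
        exact lintegral_indicator_one₀ (hlevel N)
    _ ≤ μ univ + ∑' N : ℕ, L ^ δ * μ univ * (L ^ δ * θ) ^ N := by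
        refine add_le_add_right (ENNReal.tsum_le_tsum fun N => ?_) _
        calc (L ^ δ) ^ (N + 1) * μ {x | L ^ N < f x} ≤ (L ^ δ) ^ (N + 1) * (θ ^ N * μ univ) := by
              gcongr
              exact h N
          _ = L ^ δ * μ univ * (L ^ δ * θ) ^ N := by ring
    _ = (1 + L ^ δ * (1 - L ^ δ * θ)⁻¹) * μ univ := by
        rw [ENNReal.tsum_mul_left, ENNReal.tsum_geometric]
        ring

theorem exists_rpow_mul_lt_one {L θ : ℝ≥0∞} (hL0 : L ≠ 0) (hL_top : L ≠ ∞) (hθ : θ < 1) :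
    ∃ δ : ℝ, 0 < δ ∧ L ^ δ * θ < 1 := by
  lift L to ℝ≥0 using hL_top
  lift θ to ℝ≥0 using hθ.ne_top
  norm_cast at hL0 hθ
  have hlim : Tendsto (fun δ : ℝ => L ^ δ * θ) (𝓝[>] 0) (𝓝 θ) := by
    have hpow : Tendsto (fun δ : ℝ => L ^ δ) (𝓝 0) (𝓝 1) := by
      simpa only [NNReal.rpow_zero, id_eq] using
        (tendsto_const_nhds (x := L)).nnrpow (tendsto_id (x := 𝓝 0)) (Or.inl hL0)
    simpa using (hpow.mono_left nhdsWithin_le_nhds).mul_const θ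
  obtain ⟨δ, hδ, hδθ⟩ := (eventually_mem_nhdsWithin.and (hlim.eventually_lt_const hθ)).exists
  exact ⟨δ, hδ, by rw [← ENNReal.coe_rpow_of_ne_zero hL0]; exact_mod_cast hδθ⟩

theorem measureReal_inter_sub_le {A B : Set α} (hAB : A ⊆ B) (hA : NullMeasurableSet A μ)
    (hB_top : μ B ≠ ∞) (E : Set α) :
    μ.real (E ∩ B) - μ.real (E ∩ A) ≤ μ.real B - μ.real A := by
  have hcover : E ∩ B ⊆ (E ∩ A) ∪ (B \ A) := fun x ⟨hxE, hxB⟩ => by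
    by_cases hxA : x ∈ A
    · exact Or.inl ⟨hxE, hxA⟩
    · exact Or.inr ⟨hxB, hxA⟩
  have htop : μ ((E ∩ A) ∪ (B \ A)) ≠ ∞ :=
    measure_ne_top_of_subset (union_subset (inter_subset_right.trans hAB) sdiff_subset) hB_top
  have hle := (measureReal_mono hcover htop).trans (measureReal_union_le _ _)
  have hsdiff : μ.real (B \ A) = μ.real B - μ.real A := by
    rw [measureReal_def, measure_sdiff hAB hA (measure_ne_top_of_subset hAB hB_top),
      ENNReal.toReal_sub_of_le (measure_mono hAB) hB_top, measureReal_def, measureReal_def]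
  linarith

theorem continuousOn_measureReal_inter {ι : Type*} [LinearOrder ι] [TopologicalSpace ι]
    {B : ι → Set α} (hB : Monotone B) (hBm : ∀ s, NullMeasurableSet (B s) μ)
    (hB_top : ∀ s, μ (B s) ≠ ∞) {I : Set ι} (hcont : ContinuousOn (fun s => μ.real (B s)) I)
    (E : Set α) : ContinuousOn (fun s => μ.real (E ∩ B s)) I := by
  have hdist (s t : ι) :
      dist (μ.real (E ∩ B s)) (μ.real (E ∩ B t)) ≤ dist (μ.real (B s)) (μ.real (B t)) := by
    wlog hst : s ≤ t generalizing s t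
    · rw [dist_comm, dist_comm (μ.real (B s))]
      exact this t s (le_of_not_ge hst)
    have hmono : μ.real (E ∩ B s) ≤ μ.real (E ∩ B t) :=
      measureReal_mono (inter_subset_inter_right E (hB hst))
        (measure_ne_top_of_subset inter_subset_right (hB_top t))
    rw [dist_comm, dist_comm (μ.real (B s)), Real.dist_eq, Real.dist_eq,
      abs_of_nonneg (sub_nonneg.2 hmono)]
    exact (measureReal_inter_sub_le (hB hst) (hBm s) (hB_top t) E).trans (le_abs_self _)
  exact fun a ha => tendsto_iff_dist_tendsto_zero.2 <|
    squeeze_zero (fun _ => dist_nonneg) (fun s => hdist s a)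
      (tendsto_iff_dist_tendsto_zero.1 (hcont a ha))

theorem mul_withDensity_le_mul_measure [SFinite μ] {f : α → ℝ≥0∞} {L a : ℝ≥0∞} (hL : L ≠ ∞)
    {S : Set α} (h : ∀ x ∈ S, L * f x ≤ a) : L * μ.withDensity f S ≤ a * μ S := by
  rw [withDensity_apply' _ S, ← lintegral_const_mul' _ _ hL, ← setLIntegral_const]
  exact setLIntegral_mono measurable_const h

/-- The quantity whose supremum over all cubes `Q` is `[w]_{A_q}`, with respect to a general
reference measure `μ`. -/
noncomputable def apProduct (μ : Measure α) (q : ℝ) (w : α → ℝ≥0) (Q : Set α) : ℝ≥0∞ :=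
  (∫⁻ x in Q, (w x : ℝ≥0∞) ∂μ) / μ Q *
    ((∫⁻ x in Q, (w x : ℝ≥0∞) ^ (-1 / (q - 1)) ∂μ) / μ Q) ^ (q - 1)

theorem lintegral_mul_lintegral_dual_eq_apProduct_mul {w : α → ℝ≥0} {q : ℝ} (hq : 1 ≤ q) {Q : Set α}
    (hQ0 : μ Q ≠ 0) (hQ_top : μ Q ≠ ∞) :
    (∫⁻ x in Q, (w x : ℝ≥0∞) ∂μ) * (∫⁻ x in Q, (w x : ℝ≥0∞) ^ (-1 / (q - 1)) ∂μ) ^ (q - 1) =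
      apProduct μ q w Q * μ Q ^ q := by
  have hpow : μ Q ^ q = μ Q * μ Q ^ (q - 1) := by
    nth_rw 2 [← ENNReal.rpow_one (μ Q)]
    rw [← ENNReal.rpow_add _ _ hQ0 hQ_top, add_sub_cancel]
  rw [hpow, apProduct, mul_mul_mul_comm, ENNReal.div_mul_cancel hQ0 hQ_top,
    ← ENNReal.mul_rpow_of_nonneg _ _ (sub_nonneg.2 hq), ENNReal.div_mul_cancel hQ0 hQ_top]

end MeasureSpace

section ShrunkBall

variable {E : Type*} [NormedAddCommGroup E] [NormedSpace ℝ E]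

/-- The image of `closedBall c r` under the homothety with centre `x` and ratio `s`. For
`x ∈ closedBall c r` these balls all contain `x` and shrink to it as `s → 0`. -/
def shrunkBall (x c : E) (r s : ℝ) : Set E :=
  closedBall (AffineMap.lineMap x c s) (s * r)

theorem shrunkBall_one (x c : E) (r : ℝ) : shrunkBall x c r 1 = closedBall c r := by
  simp [shrunkBall]

theorem monotone_shrunkBall {x c : E} {r : ℝ} (hx : x ∈ closedBall c r) :
    Monotone (shrunkBall x c r) := fun s t hst => by
  refine closedBall_subset_closedBall' ?_
  rw [dist_lineMap_lineMap, dist_comm s t, Real.dist_eq, abs_of_nonneg (sub_nonneg.2 hst)]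
  nlinarith [mem_closedBall.1 hx]

theorem shrunkBall_subset {x c : E} {r s : ℝ} (hx : x ∈ closedBall c r) (hs : s ≤ 1) :
    shrunkBall x c r s ⊆ closedBall c r :=
  (monotone_shrunkBall hx hs).trans_eq (shrunkBall_one x c r)

theorem mem_shrunkBall {x c : E} {r s : ℝ} (hx : x ∈ closedBall c r) (hs : 0 ≤ s) :
    x ∈ shrunkBall x c r s := by
  rw [shrunkBall, mem_closedBall, dist_left_lineMap, Real.norm_of_nonneg hs]
  gcongr
  exact hx

variable [FiniteDimensional ℝ E] [MeasurableSpace E] [BorelSpace E] {ν : Measure E}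
  [ν.IsAddHaarMeasure]

theorem measure_shrunkBall (x c : E) (r : ℝ) {s : ℝ} (hs : 0 < s) :
    ν (shrunkBall x c r s) = ENNReal.ofReal (s ^ finrank ℝ E) * ν (closedBall c r) := by
  rw [shrunkBall, Measure.addHaar_closedBall_mul_of_pos _ _ hs,
    Measure.addHaar_closedBall_center ν c]

theorem ae_tendsto_measure_inter_shrunkBall_div (S : Set E) :
    ∀ᵐ x ∂ν.restrict S, ∀ c r, 0 < r → x ∈ closedBall c r →
      Tendsto (fun s => ν (S ∩ shrunkBall x c r s) / ν (shrunkBall x c r s)) (𝓝[>] 0) (𝓝 1) := by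
  filter_upwards [IsUnifLocDoublingMeasure.ae_tendsto_measure_inter_div ν S 1] with x hx c r hr hxc
  have hradius : Tendsto (fun s : ℝ => s * r) (𝓝[>] 0) (𝓝[>] 0) := by
    refine tendsto_nhdsWithin_iff.2
      ⟨?_, eventually_mem_nhdsWithin.mono fun s hs => mul_pos hs hr⟩
    simpa using (tendsto_id.mul_const r).mono_left (nhdsWithin_le_nhds (a := (0 : ℝ)))
  refine hx _ _ hradius (eventually_mem_nhdsWithin.mono fun s hs => ?_)
  rw [one_mul]
  exact mem_shrunkBall hxc (le_of_lt hs)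

theorem nullMeasurableSet_of_forall_exists_closedBall {U : Set E}
    (hU : ∀ x ∈ U, ∃ c r, 0 < r ∧ x ∈ closedBall c r ∧ closedBall c r ⊆ U) :
    NullMeasurableSet U ν := by
  have hnull : ν (U \ interior U) = 0 := by
    have hdensity := (ae_restrict_iff'₀ isOpen_interior.measurableSet.compl.nullMeasurableSet).1
      (ae_tendsto_measure_inter_shrunkBall_div (ν := ν) (interior U)ᶜ)
    rw [measure_eq_zero_iff_ae_notMem]
    filter_upwards [hdensity] with x hlim ⟨hxU, hx⟩
    obtain ⟨c, r, hr, hxc, hcU⟩ := hU x hxU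
    refine zero_ne_one (tendsto_nhds_unique (tendsto_const_nhds.congr' ?_) (hlim hx c r hr hxc))
    filter_upwards [Ioc_mem_nhdsGT (zero_lt_one (α := ℝ))] with s hs
    have hsphere : (interior U)ᶜ ∩ shrunkBall x c r s ⊆
        sphere (AffineMap.lineMap x c s) (s * r) := fun y ⟨hyU, hy⟩ => by
      rw [← closedBall_sdiff_ball]
      exact ⟨hy, fun hy' => hyU <| interior_maximal
        (ball_subset_closedBall.trans ((shrunkBall_subset hxc hs.2).trans hcU)) isOpen_ball hy'⟩
    rw [measure_mono_null hsphere (Measure.addHaar_sphere_of_ne_zero ν _ (mul_pos hs.1 hr).ne'),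
      ENNReal.zero_div]
  rw [← union_sdiff_cancel (interior_subset (s := U))]
  exact isOpen_interior.measurableSet.nullMeasurableSet.union (.of_null hnull)

theorem exists_measure_shrunkBall_eq_two_mul {S : Set E} {x c : E} {r s₀ : ℝ}
    (hx : x ∈ closedBall c r) (hs₀ : 0 < s₀) (hs₀1 : s₀ ≤ 1)
    (hlarge : ν (shrunkBall x c r s₀) ≤ 2 * ν (S ∩ shrunkBall x c r s₀))
    (hsmall : 2 * ν (S ∩ closedBall c r) ≤ ν (closedBall c r)) :
    ∃ s ∈ Icc s₀ 1, ν (shrunkBall x c r s) = 2 * ν (S ∩ shrunkBall x c r s) := by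
  have htop (s : ℝ) : ν (shrunkBall x c r s) ≠ ∞ := measure_closedBall_lt_top.ne
  have htop' (s : ℝ) : 2 * ν (S ∩ shrunkBall x c r s) ≠ ∞ :=
    ENNReal.mul_ne_top (by simp) (measure_ne_top_of_subset inter_subset_right (htop s))
  have hreal (s : ℝ) :
      (2 * ν (S ∩ shrunkBall x c r s)).toReal = 2 * ν.real (S ∩ shrunkBall x c r s) := by
    rw [ENNReal.toReal_mul, ENNReal.toReal_ofNat, measureReal_def]
  have hvol : ContinuousOn (fun s => ν.real (shrunkBall x c r s)) (Icc s₀ 1) := by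
    refine ContinuousOn.congr (f := fun s => s ^ finrank ℝ E * ν.real (closedBall c r))
      (by fun_prop) fun s hs => ?_
    have hs0 := hs₀.trans_le hs.1
    rw [measureReal_def, measure_shrunkBall x c r hs0, ENNReal.toReal_mul,
      ENNReal.toReal_ofReal (by positivity), measureReal_def]
  have hinter : ContinuousOn (fun s => 2 * ν.real (S ∩ shrunkBall x c r s)) (Icc s₀ 1) :=
    continuousOn_const.mul <| continuousOn_measureReal_inter (monotone_shrunkBall hx)
      (fun s => measurableSet_closedBall.nullMeasurableSet) htop hvol S
  rw [← shrunkBall_one x c r] at hsmall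
  obtain ⟨s, hs, hs_eq⟩ := isPreconnected_Icc.intermediate_value₂ (left_mem_Icc.2 hs₀1)
    (right_mem_Icc.2 hs₀1) hvol hinter
    ((ENNReal.toReal_mono (htop' s₀) hlarge).trans_eq (hreal s₀))
    ((hreal 1).symm.trans_le (ENNReal.toReal_mono (htop 1) hsmall))
  exact ⟨s, hs, (ENNReal.toReal_eq_toReal_iff' (htop s) (htop' s)).1 (hs_eq.trans (hreal s).symm)⟩

theorem ae_exists_half_filled_closedBall {S : Set E} (hSm : NullMeasurableSet S ν) {c : E} {r : ℝ}
    (hr : 0 < r) (hS : S ⊆ closedBall c r) (h : 2 * ν S ≤ ν (closedBall c r)) :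
    ∀ᵐ x ∂ν, x ∈ S → ∃ c' r', 0 < r' ∧ r' ≤ r ∧ x ∈ closedBall c' r' ∧
      closedBall c' r' ⊆ closedBall c r ∧
        ν (closedBall c' r') = 2 * ν (S ∩ closedBall c' r') := by
  filter_upwards [(ae_restrict_iff'₀ hSm).1 (ae_tendsto_measure_inter_shrunkBall_div S)]
    with x hlim hxS
  have hx := hS hxS
  obtain ⟨s₀, hdens, hs₀, hs₀1⟩ :=
    (((hlim hxS c r hr hx).eventually_const_lt (ENNReal.inv_lt_one.2 ENNReal.one_lt_two)).and
      (Ioc_mem_nhdsGT one_pos)).exists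
  have hlarge : ν (shrunkBall x c r s₀) ≤ 2 * ν (S ∩ shrunkBall x c r s₀) := by
    rw [← ENNReal.inv_mul_le_iff (by simp) (by simp)]
    exact (ENNReal.le_div_iff_mul_le
      (Or.inl (measure_closedBall_pos ν _ (mul_pos hs₀ hr)).ne')
      (Or.inl measure_closedBall_lt_top.ne)).1 hdens.le
  obtain ⟨s, ⟨hs, hs1⟩, hhalf⟩ := exists_measure_shrunkBall_eq_two_mul hx hs₀ hs₀1 hlarge
    (by rwa [inter_eq_left.2 hS])
  have hs0 := hs₀.trans_le hs
  exact ⟨_, _, mul_pos hs0 hr, mul_le_of_le_one_left hr.le hs1, mem_shrunkBall hx hs0.le,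
    shrunkBall_subset hx hs1, hhalf⟩

end ShrunkBall

section HalfDensityHull

variable {E : Type*} [NormedAddCommGroup E] [MeasurableSpace E] {ν μ : Measure E} {K : ℝ≥0}

/-- The union of the balls at least half of which, with respect to `ν`, is filled by `S`. -/
def halfDensityHull (ν : Measure E) (S : Set E) : Set E :=
  {x | ∃ c r, 0 < r ∧ x ∈ closedBall c r ∧ ν (closedBall c r) ≤ 2 * ν (S ∩ closedBall c r)}

/-- Passing to the half-density hull increases `μ` by a factor of at most `K`. For `μ = w dx` this
is the property through which the boundedness of the median maximal operator is compared with
`A_∞`. -/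
def HullBoundedWith (ν : Measure E) (K : ℝ≥0) (μ : Measure E) : Prop :=
  ∀ S, NullMeasurableSet S ν → μ (halfDensityHull ν S) ≤ K * μ S

theorem closedBall_subset_halfDensityHull {S : Set E} {c : E} {r : ℝ} (hr : 0 < r)
    (h : ν (closedBall c r) ≤ 2 * ν (S ∩ closedBall c r)) :
    closedBall c r ⊆ halfDensityHull ν S :=
  fun _ hx => ⟨c, r, hr, hx, h⟩

theorem HullBoundedWith.measure_closedBall_le (h : HullBoundedWith ν K μ) {S : Set E}
    (hS : NullMeasurableSet S ν) {c : E} {r : ℝ} (hr : 0 < r)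
    (hdens : ν (closedBall c r) ≤ 2 * ν (S ∩ closedBall c r)) : μ (closedBall c r) ≤ K * μ S :=
  (measure_mono (closedBall_subset_halfDensityHull hr hdens)).trans (h S hS)

end HalfDensityHull

section HullGrowth

variable {E : Type*} [NormedAddCommGroup E] [NormedSpace ℝ E]

variable (E) in
/-- The factor by which the `ν`-measure of a set filling at most half of a ball grows when half
filled subballs are added to the set. -/
noncomputable def hullGrowth : ℝ≥0∞ :=
  1 + (2 * 5 ^ finrank ℝ E)⁻¹

theorem one_lt_hullGrowth : 1 < hullGrowth E :=
  ENNReal.lt_add_right ENNReal.one_ne_top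
    (ENNReal.inv_ne_zero.2 (ENNReal.mul_ne_top (by simp) (ENNReal.pow_ne_top (by simp))))

theorem hullGrowth_ne_top : hullGrowth E ≠ ∞ :=
  ENNReal.add_ne_top.2 ⟨ENNReal.one_ne_top, ENNReal.inv_ne_top.2 (by simp)⟩

variable [FiniteDimensional ℝ E]

theorem exists_disjoint_subfamily_subset_closedBall_five_mul {t : Set (E × ℝ)} {R : ℝ}
    (ht : ∀ b ∈ t, 0 < b.2 ∧ b.2 ≤ R) :
    ∃ u ⊆ t, u.Countable ∧ u.PairwiseDisjoint (fun b => closedBall b.1 b.2) ∧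
      (⋃ b ∈ t, closedBall b.1 b.2) ⊆ ⋃ b ∈ u, closedBall b.1 (5 * b.2) := by
  obtain ⟨u, hut, hdisj, hu⟩ := Vitali.exists_disjoint_subfamily_covering_enlargement_closedBall t
    Prod.fst Prod.snd R (fun b hb => (ht b hb).2) 5 (by norm_num)
  refine ⟨u, hut, hdisj.countable_of_nonempty_interior fun b hb =>
    (nonempty_ball.2 (ht b (hut hb)).1).mono ball_subset_interior_closedBall, hdisj,
    iUnion₂_subset fun b hb => ?_⟩
  obtain ⟨b', hb', hbb'⟩ := hu b hb
  exact hbb'.trans (subset_biUnion_of_mem (u := fun b : E × ℝ => closedBall b.1 (5 * b.2)) hb')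

variable [MeasurableSpace E] [BorelSpace E] {ν μ : Measure E} [ν.IsAddHaarMeasure] {K : ℝ≥0}

theorem measure_closedBall_five_mul (c : E) (r : ℝ) :
    ν (closedBall c (5 * r)) = 5 ^ finrank ℝ E * ν (closedBall c r) := by
  rw [Measure.addHaar_closedBall_mul_of_pos _ _ (by norm_num),
    Measure.addHaar_closedBall_center ν c, ENNReal.ofReal_pow (by norm_num), ENNReal.ofReal_ofNat]

theorem hullBoundedWith_of_forall_closedBall (hμν : μ ≪ ν)
    (h : ∀ (c : E) (r : ℝ) (F : Set E), 0 < r → F ⊆ closedBall c r →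
      ν (closedBall c r) ≤ 2 * 5 ^ finrank ℝ E * ν F → μ (closedBall c r) ≤ K * μ F) :
    HullBoundedWith ν K μ := fun S hS => by
  let t (R : ℕ) : Set (E × ℝ) :=
    {b | (0 < b.2 ∧ b.2 ≤ R) ∧ ν (closedBall b.1 b.2) ≤ 2 * ν (S ∩ closedBall b.1 b.2)}
  have hmono : Monotone fun R => ⋃ b ∈ t R, closedBall b.1 b.2 := fun R R' hR =>
    biUnion_subset_biUnion_left fun b hb =>
      ⟨⟨hb.1.1, hb.1.2.trans (Nat.cast_le.2 hR)⟩, hb.2⟩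
  have hhull : halfDensityHull ν S ⊆ ⋃ R, ⋃ b ∈ t R, closedBall b.1 b.2 := by
    rintro x ⟨c, r, hr, hx, hdens⟩
    obtain ⟨R, hR⟩ := exists_nat_ge r
    exact mem_iUnion.2 ⟨R, mem_iUnion₂.2 ⟨(c, r), ⟨⟨hr, hR⟩, hdens⟩, hx⟩⟩
  refine (measure_mono hhull).trans ?_
  rw [hmono.measure_iUnion]
  refine iSup_le fun R => ?_
  obtain ⟨u, hut, hu_count, hdisj, hcover⟩ :=
    exists_disjoint_subfamily_subset_closedBall_five_mul (t := t R) fun b hb => hb.1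
  have hball (b : E × ℝ) (hb : b ∈ u) :
      μ (closedBall b.1 (5 * b.2)) ≤ K * μ (S ∩ closedBall b.1 b.2) := by
    obtain ⟨⟨hb0, -⟩, hdens⟩ := hut hb
    refine h _ _ _ (by positivity)
      (inter_subset_right.trans (closedBall_subset_closedBall (by linarith))) ?_
    rw [measure_closedBall_five_mul, mul_right_comm, mul_comm]
    gcongr
  calc μ (⋃ b ∈ t R, closedBall b.1 b.2)
      ≤ ∑' b : u, μ (closedBall b.1.1 (5 * b.1.2)) :=
        (measure_mono hcover).trans (measure_biUnion_le _ hu_count _)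
    _ ≤ ∑' b : u, K * μ (S ∩ closedBall b.1.1 b.1.2) :=
        ENNReal.tsum_le_tsum fun b => hball b.1 b.2
    _ = K * μ (⋃ b ∈ u, S ∩ closedBall b.1 b.2) := by
        rw [ENNReal.tsum_mul_left, measure_biUnion₀ hu_count
          (fun b hb b' hb' hne => ((hdisj hb hb' hne).mono inter_subset_right
            inter_subset_right).aedisjoint)
          fun b _ => (hS.mono_ac hμν).inter measurableSet_closedBall.nullMeasurableSet]
    _ ≤ K * μ S := by
        gcongr
        exact iUnion₂_subset fun _ _ => inter_subset_left

theorem exists_subset_halfDensityHull {S : Set E} (hSm : NullMeasurableSet S ν) {c : E} {r : ℝ}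
    (hr : 0 < r) (hS : S ⊆ closedBall c r) (h : 2 * ν S ≤ ν (closedBall c r)) :
    ∃ U ⊆ closedBall c r, MeasurableSet U ∧ U ⊆ halfDensityHull ν S ∧ ν U = 2 * ν (S ∩ U) ∧
      ν S ≤ 5 ^ finrank ℝ E * ν U := by
  let t : Set (E × ℝ) := {b | (0 < b.2 ∧ b.2 ≤ r) ∧ closedBall b.1 b.2 ⊆ closedBall c r ∧
    ν (closedBall b.1 b.2) = 2 * ν (S ∩ closedBall b.1 b.2)}
  obtain ⟨u, hut, hu_count, hdisj, hcover⟩ :=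
    exists_disjoint_subfamily_subset_closedBall_five_mul (t := t) fun b hb => hb.1
  have hU : ν (⋃ b ∈ u, closedBall b.1 b.2) = ∑' b : u, ν (closedBall b.1.1 b.1.2) :=
    measure_biUnion hu_count hdisj fun _ _ => measurableSet_closedBall
  have hSt : S ≤ᵐ[ν] ⋃ b ∈ t, closedBall b.1 b.2 := by
    filter_upwards [ae_exists_half_filled_closedBall hSm hr hS h] with x hx hxS
    obtain ⟨c', r', hr', hr'r, hxc', hsub, hhalf⟩ := hx hxS
    exact mem_iUnion₂.2 ⟨(c', r'), ⟨⟨hr', hr'r⟩, hsub, hhalf⟩, hxc'⟩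
  refine ⟨⋃ b ∈ u, closedBall b.1 b.2, iUnion₂_subset fun b hb => (hut hb).2.1,
    .biUnion hu_count fun _ _ => measurableSet_closedBall,
    iUnion₂_subset fun b hb =>
      closedBall_subset_halfDensityHull (hut hb).1.1 (hut hb).2.2.le, ?_, ?_⟩
  · rw [hU, inter_iUnion₂, measure_biUnion₀ hu_count
      (fun b hb b' hb' hne => ((hdisj hb hb' hne).mono inter_subset_right
        inter_subset_right).aedisjoint)
      fun b _ => hSm.inter measurableSet_closedBall.nullMeasurableSet, ← ENNReal.tsum_mul_left]
    exact tsum_congr fun b => (hut b.2).2.2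
  · calc ν S ≤ ν (⋃ b ∈ u, closedBall b.1 (5 * b.2)) :=
          (measure_mono_ae hSt).trans (measure_mono hcover)
      _ ≤ ∑' b : u, ν (closedBall b.1.1 (5 * b.1.2)) := measure_biUnion_le _ hu_count _
      _ = 5 ^ finrank ℝ E * ν (⋃ b ∈ u, closedBall b.1 b.2) := by
          simp_rw [measure_closedBall_five_mul, ENNReal.tsum_mul_left, hU]

theorem HullBoundedWith.exists_hullGrowth_mul_le (hK : HullBoundedWith ν K μ) {S : Set E}
    (hSm : NullMeasurableSet S ν) {c : E} {r : ℝ} (hr : 0 < r) (hS : S ⊆ closedBall c r)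
    (h : 2 * ν S ≤ ν (closedBall c r)) :
    ∃ F ⊆ closedBall c r, NullMeasurableSet F ν ∧ hullGrowth E * ν S ≤ ν F ∧
      μ F ≤ (K + 1) * μ S := by
  obtain ⟨U, hU, hUm, hUhull, hUhalf, hSU⟩ := exists_subset_halfDensityHull hSm hr hS h
  have hSU_top : ν (S ∩ U) ≠ ∞ :=
    measure_ne_top_of_subset (inter_subset_right.trans hU) measure_closedBall_lt_top.ne
  have hsdiff : ν (U \ S) = ν (S ∩ U) := by
    have hsplit := measure_inter_add_sdiff₀ U hSm
    rw [hUhalf, two_mul, inter_comm] at hsplit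
    exact (ENNReal.add_right_inj hSU_top).1 hsplit
  refine ⟨S ∪ U, union_subset hS hU, hSm.union hUm.nullMeasurableSet, ?_, ?_⟩
  · calc hullGrowth E * ν S = ν S + (2 * 5 ^ finrank ℝ E)⁻¹ * ν S := by
          rw [hullGrowth, add_mul, one_mul]
      _ ≤ ν S + ν (U \ S) := by
          gcongr
          rw [ENNReal.inv_mul_le_iff (by simp)
            (ENNReal.mul_ne_top (by simp) (ENNReal.pow_ne_top (by simp))), hsdiff,
            mul_right_comm, ← hUhalf, mul_comm]
          exact hSU
      _ = ν (S ∪ U) := by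
          rw [← union_sdiff_self, measure_union₀ (hUm.nullMeasurableSet.diff hSm)
            disjoint_sdiff_right.aedisjoint]
  · calc μ (S ∪ U) ≤ μ S + μ (halfDensityHull ν S) :=
          (measure_union_le _ _).trans (by gcongr)
      _ ≤ μ S + K * μ S := by
          gcongr
          exact hK S hSm
      _ = (K + 1) * μ S := by ring

theorem HullBoundedWith.measure_closedBall_le_pow_mul (hK : HullBoundedWith ν K μ) {c : E} {r : ℝ}
    (hr : 0 < r) (N : ℕ) {S : Set E} (hSm : NullMeasurableSet S ν) (hS : S ⊆ closedBall c r)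
    (h : ν (closedBall c r) ≤ 2 * (hullGrowth E ^ N * ν S)) :
    μ (closedBall c r) ≤ (K + 1) ^ (N + 1) * μ S := by
  have hlarge {S : Set E} (hSm : NullMeasurableSet S ν) (hS : S ⊆ closedBall c r)
      (h : ν (closedBall c r) ≤ 2 * ν S) (N : ℕ) :
      μ (closedBall c r) ≤ (K + 1) ^ (N + 1) * μ S :=
    calc μ (closedBall c r) ≤ K * μ S :=
          hK.measure_closedBall_le hSm hr (by rwa [inter_eq_left.2 hS])
      _ ≤ (K + 1) ^ (N + 1) * μ S := by
          gcongr
          exact le_self_add.trans (le_self_pow₀ le_add_self N.succ_ne_zero)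
  induction N generalizing S with
  | zero => exact hlarge hSm hS (by simpa using h) 0
  | succ N ih =>
    rcases le_total (ν (closedBall c r)) (2 * ν S) with hS_large | hS_small
    · exact hlarge hSm hS hS_large (N + 1)
    obtain ⟨F, hF, hFm, hνF, hμF⟩ := hK.exists_hullGrowth_mul_le hSm hr hS hS_small
    calc μ (closedBall c r) ≤ (K + 1) ^ (N + 1) * μ F :=
          ih hFm hF <| h.trans <| by
            rw [pow_succ, mul_assoc (hullGrowth E ^ N)]
            gcongr
      _ ≤ (K + 1) ^ (N + 1) * ((K + 1) * μ S) := by gcongr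
      _ = (K + 1) ^ (N + 1 + 1) * μ S := by ring

end HullGrowth

section Weight

variable {E : Type*} [NormedAddCommGroup E] [NormedSpace ℝ E] [FiniteDimensional ℝ E]
  [MeasurableSpace E] {ν μ : Measure E} [ν.IsAddHaarMeasure] {K : ℝ≥0}

theorem HullBoundedWith.measure_closedBall_ne_top [SigmaFinite μ] (h : HullBoundedWith ν K μ)
    (c : E) {r : ℝ} (hr : 0 < r) : μ (closedBall c r) ≠ ∞ := by
  have hmono : Monotone fun k => spanningSets μ k ∩ closedBall c r :=
    fun k l hkl => inter_subset_inter_left _ (monotone_spanningSets μ hkl)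
  have hhalf : ν (closedBall c r) / 2 < ⨆ k, ν (spanningSets μ k ∩ closedBall c r) := by
    rw [← hmono.measure_iUnion, ← iUnion_inter, iUnion_spanningSets, univ_inter]
    exact ENNReal.half_lt_self (measure_closedBall_pos ν c hr).ne' measure_closedBall_lt_top.ne
  obtain ⟨k, hk⟩ := lt_iSup_iff.1 hhalf
  exact ne_top_of_le_ne_top
    (ENNReal.mul_ne_top ENNReal.coe_ne_top (measure_spanningSets_lt_top μ k).ne)
    (h.measure_closedBall_le (measurableSet_spanningSets μ k).nullMeasurableSet hr
      ((ENNReal.div_le_iff' (by simp) (by simp)).1 hk.le))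

theorem add_one_pow_succ_lt_add_two_sq_pow {R : Type*} [Semiring R] [PartialOrder R]
    [IsStrictOrderedRing R] {x : R} (hx : 0 ≤ x) {N : ℕ} (hN : N ≠ 0) :
    (x + 1) ^ (N + 1) < ((x + 2) ^ 2) ^ N :=
  calc (x + 1) ^ (N + 1) ≤ (x + 1) ^ (2 * N) :=
        pow_le_pow_right₀ (le_add_of_nonneg_left hx) (by lia)
    _ < (x + 2) ^ (2 * N) :=
        pow_lt_pow_left₀ (add_lt_add_right one_lt_two x) (by positivity) (by lia)
    _ = ((x + 2) ^ 2) ^ N := pow_mul _ _ _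

variable [BorelSpace E] {w : E → ℝ≥0}

theorem hullBoundedWith_of_apProduct_le (hw : AEMeasurable w ν) {q : ℝ} (hq : 1 < q) {A : ℝ≥0∞}
    (hA : A ≠ ∞) (h : ∀ c r, 0 < r → apProduct ν q w (closedBall c r) ≤ A) :
    HullBoundedWith ν ((2 * 5 ^ finrank ℝ E) ^ q * A).toNNReal
      (ν.withDensity fun x => (w x : ℝ≥0∞)) := by
  refine hullBoundedWith_of_forall_closedBall (withDensity_absolutelyContinuous _ _)
    fun c r F hr hFQ hD => ?_
  have hQ0 := (measure_closedBall_pos ν c hr).ne'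
  have hQ_top : ν (closedBall c r) ≠ ∞ := measure_closedBall_lt_top.ne
  rw [ENNReal.coe_toNNReal (ENNReal.mul_ne_top (ENNReal.rpow_ne_top_of_nonneg (by positivity)
    (ENNReal.mul_ne_top (by simp) (ENNReal.pow_ne_top (by simp)))) hA),
    withDensity_apply' _ F, withDensity_apply' _ (closedBall c r)]
  refine setLIntegral_le_of_measure_le_mul hw.coe_nnreal_ennreal
    (.of_forall fun _ => ENNReal.coe_ne_top) hq hFQ hQ0 hQ_top hA ?_ hD
  rw [lintegral_mul_lintegral_dual_eq_apProduct_mul hq.le hQ0 hQ_top]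
  gcongr
  exact h c r hr

theorem HullBoundedWith.measure_lt_average_le (hw : AEMeasurable w ν)
    (h : HullBoundedWith ν K (ν.withDensity fun x => (w x : ℝ≥0∞))) (c : E) {r : ℝ} (hr : 0 < r)
    (N : ℕ) :
    ν (closedBall c r ∩ {x | ((K + 2) ^ 2) ^ N * (w x : ℝ≥0∞) <
        (∫⁻ x in closedBall c r, (w x : ℝ≥0∞) ∂ν) / ν (closedBall c r)}) ≤
      (hullGrowth E)⁻¹ ^ N * ν (closedBall c r) := by
  obtain rfl | hN := eq_or_ne N 0
  · simpa using measure_mono inter_subset_left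
  rw [← withDensity_apply' _ (closedBall c r)]
  set μ := ν.withDensity fun x => (w x : ℝ≥0∞)
  set Q := closedBall c r
  set S := Q ∩ {x | ((K + 2) ^ 2) ^ N * (w x : ℝ≥0∞) < μ Q / ν Q}
  have hS : NullMeasurableSet S ν := measurableSet_closedBall.nullMeasurableSet.inter
    (nullMeasurableSet_lt (hw.coe_nnreal_ennreal.const_mul _) aemeasurable_const)
  by_contra! hlt
  have hνQ0 : ν Q ≠ 0 := (measure_closedBall_pos ν c hr).ne'
  have hμQ0 : μ Q ≠ 0 := fun h0 => by simp [S, h0] at hlt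
  have hμQ_top : μ Q ≠ ∞ := h.measure_closedBall_ne_top c hr
  have hνQS : ν Q ≤ hullGrowth E ^ N * ν S := by
    rw [← ENNReal.inv_pow] at hlt
    exact (ENNReal.inv_mul_le_iff (pow_ne_zero _ (one_pos.trans one_lt_hullGrowth).ne')
      (ENNReal.pow_ne_top hullGrowth_ne_top)).1 hlt.le
  have hμQS : μ Q ≤ (K + 1) ^ (N + 1) * μ S :=
    h.measure_closedBall_le_pow_mul hr N hS inter_subset_left
      (hνQS.trans (le_mul_of_one_le_left' one_le_two))
  have hμS : ((K + 2) ^ 2) ^ N * μ S ≤ μ Q :=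
    calc ((K + 2) ^ 2) ^ N * μ S ≤ μ Q / ν Q * ν S :=
          mul_withDensity_le_mul_measure (by finiteness) fun x hx => hx.2.le
      _ ≤ μ Q / ν Q * ν Q := by
          gcongr
          exact inter_subset_left
      _ = μ Q := ENNReal.div_mul_cancel hνQ0 measure_closedBall_lt_top.ne
  have hpow : (((K + 2) ^ 2) ^ N : ℝ≥0∞) ≤ (K + 1) ^ (N + 1) := by
    refine (ENNReal.mul_le_mul_iff_left hμQ0 hμQ_top).1 ?_
    calc ((K + 2) ^ 2) ^ N * μ Q ≤ (K + 1) ^ (N + 1) * (((K + 2) ^ 2) ^ N * μ S) := by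
          rw [mul_left_comm]
          gcongr
      _ ≤ (K + 1) ^ (N + 1) * μ Q := by gcongr
  exact (add_one_pow_succ_lt_add_two_sq_pow K.2 hN).not_ge (by exact_mod_cast hpow)

theorem HullBoundedWith.rpow_average_mul_lintegral_rpow_neg_le (hw : AEMeasurable w ν)
    (h : HullBoundedWith ν K (ν.withDensity fun x => (w x : ℝ≥0∞))) (c : E) {r δ : ℝ} (hr : 0 < r)
    (hδ : 0 < δ) :
    ((∫⁻ x in closedBall c r, (w x : ℝ≥0∞) ∂ν) / ν (closedBall c r)) ^ δ *
        ∫⁻ x in closedBall c r, (w x : ℝ≥0∞) ^ (-δ) ∂ν ≤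
      (1 + ((K + 2) ^ 2) ^ δ * (1 - ((K + 2) ^ 2) ^ δ * (hullGrowth E)⁻¹)⁻¹) *
        ν (closedBall c r) := by
  have hL : (1 : ℝ≥0∞) < (K + 2) ^ 2 :=
    one_lt_pow₀ (ENNReal.one_lt_two.trans_le le_add_self) two_ne_zero
  have hL_top : ((K + 2) ^ 2 : ℝ≥0∞) ≠ ∞ := by finiteness
  have hdecay := h.measure_lt_average_le hw c hr
  have ha_top : (∫⁻ x in closedBall c r, (w x : ℝ≥0∞) ∂ν) / ν (closedBall c r) ≠ ∞ := by
    rw [← withDensity_apply' _ (closedBall c r)]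
    exact ENNReal.div_ne_top (h.measure_closedBall_ne_top c hr) (measure_closedBall_pos ν c hr).ne'
  set Q := closedBall c r
  set a := (∫⁻ x in Q, (w x : ℝ≥0∞) ∂ν) / ν Q
  rw [← Measure.restrict_apply_univ Q]
  calc a ^ δ * ∫⁻ x in Q, (w x : ℝ≥0∞) ^ (-δ) ∂ν = ∫⁻ x in Q, (a / w x) ^ δ ∂ν := by
        rw [← lintegral_const_mul' _ _ (ENNReal.rpow_ne_top_of_nonneg hδ.le ha_top)]
        simp_rw [ENNReal.rpow_neg, ← div_eq_mul_inv, ENNReal.div_rpow_of_nonneg _ _ hδ.le]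
    _ ≤ (1 + ((K + 2) ^ 2) ^ δ * (1 - ((K + 2) ^ 2) ^ δ * (hullGrowth E)⁻¹)⁻¹) *
          ν.restrict Q univ := by
        refine lintegral_rpow_le_of_geometric_decay
          (hw.coe_nnreal_ennreal.const_div a).restrict hL hL_top hδ fun N => ?_
        simp_rw [ENNReal.lt_div_iff_mul_lt (Or.inr (ENNReal.pow_ne_top hL_top))
          (Or.inl ENNReal.coe_ne_top)]
        rw [Measure.restrict_apply_univ, Measure.restrict_apply' measurableSet_closedBall,
          inter_comm]
        exact hdecay N

theorem HullBoundedWith.exists_apProduct_le (hw : AEMeasurable w ν)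
    (h : HullBoundedWith ν K (ν.withDensity fun x => (w x : ℝ≥0∞))) :
    ∃ q : ℝ, 1 < q ∧ ∃ A : ℝ≥0∞, A ≠ ∞ ∧ ∀ c r, 0 < r → apProduct ν q w (closedBall c r) ≤ A := by
  have hL_top : ((K + 2) ^ 2 : ℝ≥0∞) ≠ ∞ := by finiteness
  obtain ⟨δ, hδ, hδ_lt⟩ := exists_rpow_mul_lt_one (by positivity) hL_top
    (ENNReal.inv_lt_one.2 (one_lt_hullGrowth (E := E)))
  set A : ℝ≥0∞ := 1 + ((K + 2) ^ 2) ^ δ * (1 - ((K + 2) ^ 2) ^ δ * (hullGrowth E)⁻¹)⁻¹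
  have hA : A ≠ ∞ := ENNReal.add_ne_top.2 ⟨ENNReal.one_ne_top,
    ENNReal.mul_ne_top (ENNReal.rpow_ne_top_of_nonneg hδ.le hL_top)
      (ENNReal.inv_ne_top.2 (tsub_pos_of_lt hδ_lt).ne')⟩
  refine ⟨1 + δ⁻¹, by simpa, A ^ δ⁻¹, ENNReal.rpow_ne_top_of_nonneg (by positivity) hA,
    fun c r hr => ?_⟩
  have hdual := h.rpow_average_mul_lintegral_rpow_neg_le hw c hr hδ
  have hν0 := (measure_closedBall_pos ν c hr).ne'
  have hν_top : ν (closedBall c r) ≠ ∞ := measure_closedBall_lt_top.ne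
  rw [apProduct, add_sub_cancel_left, div_inv_eq_mul, neg_one_mul]
  set Q := closedBall c r
  set a := (∫⁻ x in Q, (w x : ℝ≥0∞) ∂ν) / ν Q
  calc a * ((∫⁻ x in Q, (w x : ℝ≥0∞) ^ (-δ) ∂ν) / ν Q) ^ δ⁻¹
      = ((a ^ δ * ∫⁻ x in Q, (w x : ℝ≥0∞) ^ (-δ) ∂ν) / ν Q) ^ δ⁻¹ := by
        rw [mul_div_assoc, ENNReal.mul_rpow_of_nonneg _ _ (by positivity),
          ENNReal.rpow_rpow_inv hδ.ne']
    _ ≤ A ^ δ⁻¹ := by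
        gcongr
        exact (ENNReal.div_le_iff hν0 hν_top).2 hdual

end Weight

section Cube

variable {n : ℕ}

theorem Icc_eq_closedBall (c : Fin n → ℝ) {r : ℝ} (hr : 0 < r) :
    Icc (fun i => c i - r) (fun i => c i + r) = closedBall c r := by
  rw [closedBall_pi c hr.le, ← pi_univ_Icc]
  simp only [Real.closedBall_eq_Icc]

theorem isCube_iff_exists_closedBall {Q : Set (Fin n → ℝ)} :
    IsCube Q ↔ ∃ c r, 0 < r ∧ Q = closedBall c r :=
  exists₂_congr fun c _ => and_congr_right fun hr => by rw [Icc_eq_closedBall c hr]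

theorem IsCube.subset_halfDensityHull {S Q : Set (Fin n → ℝ)} (hQ : IsCube Q)
    (h : volume Q ≤ 2 * volume (S ∩ Q)) : Q ⊆ halfDensityHull volume S := by
  obtain ⟨c, r, hr, rfl⟩ := isCube_iff_exists_closedBall.1 hQ
  exact closedBall_subset_halfDensityHull hr h

theorem mem_halfDensityHull_volume_iff {S : Set (Fin n → ℝ)} {x : Fin n → ℝ} :
    x ∈ halfDensityHull volume S ↔ ∃ Q, IsCube Q ∧ x ∈ Q ∧ volume Q ≤ 2 * volume (S ∩ Q) := by
  refine ⟨fun ⟨c, r, hr, hx, h⟩ =>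
    ⟨_, isCube_iff_exists_closedBall.2 ⟨c, r, hr, rfl⟩, hx, h⟩, fun ⟨Q, hQ, hx, h⟩ => ?_⟩
  exact hQ.subset_halfDensityHull h hx

end Cube

section MedianMaximalFunction

variable {n : ℕ} {f : (Fin n → ℝ) → ℝ} {Q : Set (Fin n → ℝ)}

theorem lt_medianMaximal_iff {x : Fin n → ℝ} {a : ℝ≥0∞} :
    a < medianMaximal f x ↔ ∃ Q, IsCube Q ∧ x ∈ Q ∧ a < ‖largestMedian f Q‖ₑ := by
  simp only [medianMaximal, lt_iSup_iff, exists_prop, Real.enorm_eq_ofReal_abs]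

theorem enorm_largestMedian_le_medianMaximal (hQ : IsCube Q) {x : Fin n → ℝ} (hx : x ∈ Q) :
    ‖largestMedian f Q‖ₑ ≤ medianMaximal f x := by
  rw [Real.enorm_eq_ofReal_abs]
  exact le_iSup₂_of_le Q hQ (le_iSup_of_le hx le_rfl)

theorem aemeasurable_medianMaximal (f : (Fin n → ℝ) → ℝ) :
    AEMeasurable (medianMaximal f) volume := by
  refine NullMeasurable.aemeasurable
    (measurable_of_Ioi (α := ℝ≥0∞) (δ := NullMeasurableSpace (Fin n → ℝ) volume) fun a =>
      nullMeasurableSet_of_forall_exists_closedBall (E := Fin n → ℝ) fun x hx => ?_)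
  obtain ⟨Q, hQ, hxQ, ha⟩ := lt_medianMaximal_iff.1 hx
  obtain ⟨c, r, hr, rfl⟩ := isCube_iff_exists_closedBall.1 hQ
  exact ⟨c, r, hr, hxQ, fun y hy => lt_medianMaximal_iff.2 ⟨_, hQ, hy, ha⟩⟩

theorem volume_le_two_mul_of_lt_enorm_largestMedian (hf : AEMeasurable f volume) (hQ : IsCube Q)
    {t : ℝ≥0∞} (h : t < ‖largestMedian f Q‖ₑ) :
    volume Q ≤ 2 * volume ({x | t < ‖f x‖ₑ} ∩ Q) := by
  obtain ⟨⟨hlt, hgt⟩, -⟩ := isLargestMedian_largestMedian hf hQ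
  set α := largestMedian f Q
  rcases le_total 0 α with hα | hα
  · refine measure_le_two_mul_of_subset_union hQ.volume_ne_top hlt fun x hx => ?_
    refine (lt_or_ge (f x) α).imp (fun hxα => ⟨hx, hxα⟩) fun hxα => ⟨h.trans_le ?_, hx⟩
    exact enorm_le_iff_norm_le.2 (abs_le_abs_of_nonneg hα hxα)
  · refine measure_le_two_mul_of_subset_union hQ.volume_ne_top hgt fun x hx => ?_
    refine (lt_or_ge α (f x)).imp (fun hxα => ⟨hx, hxα⟩) fun hxα => ⟨h.trans_le ?_, hx⟩
    exact enorm_le_iff_norm_le.2 (abs_le_abs_of_nonpos hα hxα)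

theorem setOf_lt_medianMaximal_subset (hf : AEMeasurable f volume) (t : ℝ≥0∞) :
    {x | t < medianMaximal f x} ⊆ halfDensityHull volume {x | t < ‖f x‖ₑ} := fun _ hx => by
  obtain ⟨Q, hQ, hxQ, hlt⟩ := lt_medianMaximal_iff.1 hx
  exact hQ.subset_halfDensityHull (volume_le_two_mul_of_lt_enorm_largestMedian hf hQ hlt) hxQ

theorem one_le_abs_largestMedian_indicator {S : Set (Fin n → ℝ)} (hS : NullMeasurableSet S)
    (hQ : IsCube Q) (h : volume Q ≤ 2 * volume (S ∩ Q)) :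
    1 ≤ |largestMedian (S.indicator 1) Q| := by
  have hlt : Q ∩ {x | S.indicator 1 x < (1 : ℝ)} ⊆ Q \ S :=
    fun x ⟨hxQ, hx⟩ => ⟨hxQ, fun hxS => by simp [hxS] at hx⟩
  have hgt : {x | (1 : ℝ) < S.indicator 1 x} = ∅ :=
    eq_empty_of_forall_notMem fun x (hx : (1 : ℝ) < S.indicator 1 x) =>
      hx.not_ge (indicator_apply_le' (fun _ => le_rfl) fun _ => zero_le_one)
  have hmed : IsMedian (S.indicator 1) Q 1 :=
    ⟨(measure_mono hlt).trans (measure_sdiff_le_half hS hQ.volume_ne_top h), by simp [hgt]⟩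
  have hm : AEMeasurable (S.indicator (1 : (Fin n → ℝ) → ℝ)) volume :=
    aemeasurable_one.indicator₀ hS
  simpa using (isLargestMedian_largestMedian hm hQ).2 1 hmed

theorem halfDensityHull_subset_setOf_one_le_medianMaximal {S : Set (Fin n → ℝ)}
    (hS : NullMeasurableSet S) :
    halfDensityHull volume S ⊆ {x | 1 ≤ medianMaximal (S.indicator 1) x} := fun x hx => by
  obtain ⟨Q, hQ, hxQ, hdens⟩ := mem_halfDensityHull_volume_iff.1 hx
  refine le_trans ?_ (enorm_largestMedian_le_medianMaximal hQ hxQ)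
  simpa [Real.enorm_eq_ofReal_abs] using one_le_abs_largestMedian_indicator hS hQ hdens

end MedianMaximalFunction

section BoundedOnLp

variable {n : ℕ} {w : (Fin n → ℝ) → ℝ≥0} {p : ℝ}

theorem weightMeasure_absolutelyContinuous : weightMeasure w ≪ volume :=
  withDensity_absolutelyContinuous _ _

theorem HullBoundedWith.isBoundedOnLp {K : ℝ≥0} (h : HullBoundedWith volume K (weightMeasure w))
    (hp : 0 < p) : IsBoundedOnLp medianMaximal p w := by
  have hp0 : ENNReal.ofReal p ≠ 0 := by simpa
  refine ⟨K ^ (1 / p), fun f hf _ => ⟨aemeasurable_medianMaximal f, ?_⟩⟩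
  have hpow : ∫⁻ x, medianMaximal f x ^ p ∂weightMeasure w ≤
      K * ∫⁻ x, ‖f x‖ₑ ^ p ∂weightMeasure w :=
    lintegral_rpow_le_mul_of_measure_lt_le (hf.enorm.mono_ac weightMeasure_absolutelyContinuous)
      ((aemeasurable_medianMaximal f).mono_ac weightMeasure_absolutelyContinuous) hp
      ENNReal.coe_ne_top fun t => (measure_mono (setOf_lt_medianMaximal_subset hf t)).trans
        (h _ (nullMeasurableSet_lt aemeasurable_const hf.enorm))
  rw [eLpNorm_eq_lintegral_rpow_enorm_toReal hp0 ENNReal.ofReal_ne_top,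
    eLpNorm_eq_lintegral_rpow_enorm_toReal hp0 ENNReal.ofReal_ne_top, ENNReal.toReal_ofReal hp.le,
    ENNReal.coe_rpow_of_nonneg _ (by positivity), ← ENNReal.mul_rpow_of_nonneg _ _ (by positivity)]
  simp only [enorm_eq_self]
  gcongr

theorem IsBoundedOnLp.exists_hullBoundedWith (h : IsBoundedOnLp medianMaximal p w) (hp : 0 < p) :
    ∃ K, HullBoundedWith volume K (weightMeasure w) := by
  obtain ⟨C, hC⟩ := h
  have hp0 : ENNReal.ofReal p ≠ 0 := by simpa
  refine ⟨C ^ p + 1, fun S hS => ?_⟩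
  obtain hS_top | hS_top := eq_or_ne (weightMeasure w S) ∞
  · rw [hS_top, ENNReal.mul_top (by simp)]
    exact le_top
  have hnorm : eLpNorm (S.indicator (1 : (Fin n → ℝ) → ℝ)) (ENNReal.ofReal p) (weightMeasure w) =
      weightMeasure w S ^ (1 / p) := by
    have hconst := eLpNorm_indicator_const₀ (μ := weightMeasure w) (c := (1 : ℝ))
      (hS.mono_ac weightMeasure_absolutelyContinuous) hp0 ENNReal.ofReal_ne_top
    rwa [ENNReal.toReal_ofReal hp.le, enorm_one, one_mul] at hconst
  obtain ⟨hM, hle⟩ := hC (S.indicator 1) (aemeasurable_one.indicator₀ hS) <|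
    hnorm ▸ ENNReal.rpow_lt_top_of_nonneg (by positivity) hS_top
  calc weightMeasure w (halfDensityHull volume S)
      ≤ weightMeasure w {x | 1 ≤ ‖medianMaximal (S.indicator 1) x‖ₑ} :=
        measure_mono (halfDensityHull_subset_setOf_one_le_medianMaximal hS)
    _ ≤ eLpNorm (medianMaximal (S.indicator 1)) (ENNReal.ofReal p) (weightMeasure w) ^ p := by
        have hmarkov := mul_meas_ge_le_pow_eLpNorm' (weightMeasure w) hp0 ENNReal.ofReal_ne_top
          (hM.mono_ac weightMeasure_absolutelyContinuous).aestronglyMeasurable 1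
        rwa [ENNReal.toReal_ofReal hp.le, ENNReal.one_rpow, one_mul] at hmarkov
    _ ≤ (C * weightMeasure w S ^ (1 / p)) ^ p := by
        rw [← hnorm]
        gcongr
    _ = C ^ p * weightMeasure w S := by
        rw [ENNReal.mul_rpow_of_nonneg _ _ hp.le, ← ENNReal.rpow_mul, one_div_mul_cancel hp.ne',
          ENNReal.rpow_one]
    _ ≤ (C ^ p + 1 : ℝ≥0) * weightMeasure w S := by
        rw [ENNReal.coe_add, ENNReal.coe_rpow_of_nonneg _ hp.le]
        gcongr
        exact le_self_add

end BoundedOnLp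

section AInfty

variable {n : ℕ} {w : (Fin n → ℝ) → ℝ≥0}

theorem apConst_two_le_a1Const (w : (Fin n → ℝ) → ℝ≥0) : apConst 2 w ≤ a1Const w := by
  refine iSup₂_mono fun Q hQ => ?_
  rw [show (2 : ℝ) - 1 = 1 by norm_num, div_one, ENNReal.rpow_one]
  simp only [ENNReal.rpow_neg_one]
  gcongr
  rw [ENNReal.div_le_iff hQ.volume_ne_zero hQ.volume_ne_top, ← setLIntegral_const]
  exact lintegral_mono_ae (ENNReal.ae_le_essSup _)

theorem isAInfty_iff_exists_apConst_lt_top : IsAInfty w ↔ ∃ q : ℝ, 1 < q ∧ apConst q w < ∞ :=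
  or_iff_right_of_imp fun h => ⟨2, one_lt_two, (apConst_two_le_a1Const w).trans_lt h⟩

theorem apConst_le_iff {q : ℝ} {A : ℝ≥0∞} :
    apConst q w ≤ A ↔ ∀ c r, 0 < r → apProduct volume q w (closedBall c r) ≤ A := by
  simp only [apConst, iSup_le_iff, isCube_iff_exists_closedBall, apProduct]
  exact ⟨fun h c r hr => h _ ⟨c, r, hr, rfl⟩, fun h Q ⟨c, r, hr, hQ⟩ => hQ ▸ h c r hr⟩

theorem IsAInfty.exists_hullBoundedWith (h : IsAInfty w) (hw : AEMeasurable w volume) :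
    ∃ K, HullBoundedWith volume K (weightMeasure w) := by
  obtain ⟨q, hq, hA⟩ := isAInfty_iff_exists_apConst_lt_top.1 h
  exact ⟨_, hullBoundedWith_of_apProduct_le hw hq hA.ne (apConst_le_iff.1 le_rfl)⟩

theorem HullBoundedWith.isAInfty {K : ℝ≥0} (h : HullBoundedWith volume K (weightMeasure w))
    (hw : AEMeasurable w volume) : IsAInfty w := by
  obtain ⟨q, hq, A, hA, hle⟩ := HullBoundedWith.exists_apProduct_le hw h
  exact isAInfty_iff_exists_apConst_lt_top.2 ⟨q, hq, (apConst_le_iff.2 hle).trans_lt hA.lt_top⟩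

end AInfty

end MedianMaximal

theorem mainTheorem1 {n : ℕ} (hn : 1 ≤ n) (w : (Fin n → ℝ) → ℝ≥0) (hw : AEMeasurable w volume)
    (p : ℝ) (hp : 0 < p) :
    MedianMaximal.IsBoundedOnLp MedianMaximal.medianMaximal p w ↔ MedianMaximal.IsAInfty w := by
  constructor
  · intro hbounded
    obtain ⟨K, hK⟩ := hbounded.exists_hullBoundedWith hp
    exact hK.isAInfty hw
  · intro hA
    obtain ⟨K, hK⟩ := hA.exists_hullBoundedWith hw
    exact hK.isBoundedOnLp hp
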